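/- \textbf{Theorem (OR-WDRO risk bound).} Let $\mathcal Z\subseteq\mathbb R^d$ be closed and non-empty with the Euclidean norm, $p\in[1,\infty)$, $\rho\ge 0$ and $\varepsilon\in[0,0.49]$. Write $\mathcal P(\mathcal Z)$ for the Borel probability measures on $\mathcal Z$ and $\mathcal P_p(\mathcal Z)$ for those with finite $p$-th moment. Let $\mathsf W_p$ be the $p$-Wasserstein distance (with values in $[0,\infty]$), let $\|\mu-\nu\|_{\mathrm{TV}}=\tfrac12|\mu-\nu|(\mathcal Z)$, and put $$\mathsf W_p^\varepsilon(\mu,\nu)=\inf_{\mu'\in\mathcal P(\mathcal Z),\ \|\mu'-\mu\|_{\mathrm{TV}}\le\varepsilon}\mathsf W_p(\mu',\nu),\qquad \tau_p(\mathcal G,\delta)=\sup_{\mu\in\mathcal G}\ \sup_{\mu'\in\mathcal P(\mathcal Z),\ \mu'\le\frac1{1-\delta}\mu}\mathsf W_p(\mu',\mu).$$ Let $\mathcal L$ be a family of lower semicontinuous functions $\ell:\mathcal Z\to\mathbb R$ with $\sup_{z\in\mathcal Z}\ell(z)/(1+\|z\|^p)<\infty$, let $\mathcal G\subseteq\mathcal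 P_p(\mathcal Z)$, let $\mu\in\mathcal G$, and let $\tilde\mu\in\mathcal P(\mathcal Z)$ satisfy $\mathsf W_p^\varepsilon(\tilde\mu,\mu)\le\rho$. Expectations take values in $[-\infty,\infty)$ for such $\ell$ and measures in $\mathcal P_p(\mathcal Z)$. Let $\hat\ell\in\mathcal L$ minimize over $\ell\in\mathcal L$ the worst-case risk $$\sup_{\nu\in\mathcal G:\ \mathsf W_p^\varepsilon(\tilde\mu,\nu)\le\rho}\mathbb E_\nu[\ell].$$ Set $c=2(1-2\varepsilon)^{-1/p}$ and $r=c\rho+2\tau_p(\mathcal G,2\varepsilon)\in[0,\infty]$. Then the following hold (with $0\cdot\infty=0$). 1. For every $\ell\in\mathcal L$, $$\mathbb E_\mu[\hat\ell]-\mathbb E_\mu[\ell]\le \mathcal R_{\mu,p}(r;\ell):=\sup_{\nu\in\mathcal P_p(\mathcal Z):\ \mathsf W_p(\nu,\mu)\le r}\mathbb E_\nu[\ell]-\mathbb E_\mu[\ell],$$ with differences taken in $[-\infty,\infty]$ and $(-\infty)-(-\infty)=-\infty$. 2. If $p=1$ and $\ell_\star\in\mathcal L$ minimizes $\ell\mapsto\mathbb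 E_\mu[\ell]$ over $\mathcal L$ and is Lipschitz, then $$\mathbb E_\mu[\hat\ell]-\mathbb E_\mu[\ell_\star]\le\|\ell_\star\|_{\mathrm{Lip}}\,r .$$ 3. If $p=2$ and $\ell_\star\in\mathcal L$ minimizes $\ell\mapsto\mathbb E_\mu[\ell]$ over $\mathcal L$ and is $\alpha$-smooth, then $$\mathbb E_\mu[\hat\ell]-\mathbb E_\mu[\ell_\star]\le\|\ell_\star\|_{\dot H^{1,2}(\mu)}\,r+\tfrac{\alpha}{2}\,r^2,\qquad \|\ell_\star\|_{\dot H^{1,2}(\mu)}=\mathbb E_\mu[\|\nabla\ell_\star\|^2]^{1/2}.$$ Here $\alpha$-smooth means that $\ell_\star$ is (or, if $\mathcal Z$ is not convex, extends to) a differentiable function on the convex hull of $\mathcal Z$ with a gradient field satisfying $\|\nabla\ell_\star(z)-\nabla\ell_\star(z')\|\le\alpha\|z-z'\|$ for all $z,z'$ in that hull. -/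

import Mathlib

open MeasureTheory Set
open scoped ENNReal NNReal

noncomputable section

namespace ORWDRO

section General

variable {X : Type*} [MetricSpace X] [MeasurableSpace X]

/-- The couplings `Π(μ, ν)`: probability measures on `X × X` with marginals `μ` and `ν`. -/
def couplings (μ ν : ProbabilityMeasure X) : Set (ProbabilityMeasure (X × X)) :=
  {π | (π : Measure (X × X)).map Prod.fst = (μ : Measure X) ∧
       (π : Measure (X × X)).map Prod.snd = (ν : Measure X)}

/-- The `p`-Wasserstein distance `inf_π (E_π[dist(X,Y)^p])^{1/p}`, with values in `[0, ∞]`. -/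
def wasserstein (p : ℝ) (μ ν : ProbabilityMeasure X) : ℝ≥0∞ :=
  ⨅ π ∈ couplings μ ν, (∫⁻ z, edist z.1 z.2 ^ p ∂(π : Measure (X × X))) ^ (1 / p)

/-- The total variation distance `‖μ - ν‖_TV = |μ - ν|(X) / 2`. -/
def tvDistance (μ ν : ProbabilityMeasure X) : ℝ≥0∞ :=
  ((μ : Measure X).toSignedMeasure - (ν : Measure X).toSignedMeasure).totalVariation univ / 2

/-- The `ε`-outlier-robust `p`-Wasserstein distance: the infimum of `W_p(μ', ν)` over probability
measures `μ'` within total variation distance `ε` of `μ`. -/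
def robustWasserstein (p ε : ℝ) (μ ν : ProbabilityMeasure X) : ℝ≥0∞ :=
  ⨅ μ' : ProbabilityMeasure X, ⨅ _ : tvDistance μ' μ ≤ ENNReal.ofReal ε, wasserstein p μ' ν

/-- The class `P_p` of probability measures with finite `p`-th moment. -/
def finiteMoment (X : Type*) [MetricSpace X] [MeasurableSpace X] (p : ℝ) :
    Set (ProbabilityMeasure X) :=
  {μ | ⨅ z₀ : X, ∫⁻ z, edist z z₀ ^ p ∂(μ : Measure X) < ∞}

/-- The `p`-Wasserstein resilience `τ_p(μ, ε)` of a measure: the supremum of `W_p(μ', μ)` over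
probability measures `μ' ≤ μ / (1 - ε)`. -/
def resilience (p : ℝ) (μ : ProbabilityMeasure X) (ε : ℝ) : ℝ≥0∞ :=
  ⨆ μ' : ProbabilityMeasure X,
    ⨆ _ : (μ' : Measure X) ≤ ENNReal.ofReal (1 / (1 - ε)) • (μ : Measure X), wasserstein p μ' μ

/-- The `p`-Wasserstein resilience `τ_p(G, ε)` of a family of measures. -/
def classResilience (p : ℝ) (G : Set (ProbabilityMeasure X)) (ε : ℝ) : ℝ≥0∞ :=
  ⨆ μ ∈ G, resilience p μ ε

/-- The extended-real expectation `E_μ[f] = E_μ[f⁺] - E_μ[f⁻]`. It is the usual expectation when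
`f` is integrable, and it is `-∞` when `E_μ[f⁺] < ∞` and `E_μ[f⁻] = ∞`. -/
def expect (μ : ProbabilityMeasure X) (f : X → ℝ) : EReal :=
  ((∫⁻ z, ENNReal.ofReal (f z) ∂(μ : Measure X) : ℝ≥0∞) : EReal) -
    ((∫⁻ z, ENNReal.ofReal (-f z) ∂(μ : Measure X) : ℝ≥0∞) : EReal)

/-- The objective of the outlier-robust Wasserstein DRO problem: the worst-case risk of `f` over
all `ν ∈ G` with `W_p^ε(μt, ν) ≤ ρ`. -/
def worstCaseRisk (p ε : ℝ) (ρ : ℝ≥0) (G : Set (ProbabilityMeasure X))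
    (μt : ProbabilityMeasure X) (f : X → ℝ) : EReal :=
  ⨆ ν ∈ {ν : ProbabilityMeasure X | ν ∈ G ∧ robustWasserstein p ε μt ν ≤ ρ}, expect ν f

/-- The `W_p` regularizer `R_{μ,p}(r; f)`: the supremum of `E_ν[f]` over all `ν` with
`W_p(ν, μ) ≤ r`, minus `E_μ[f]`. The Wasserstein distance is a distance between measures with
finite `p`-th moment, so `ν` is taken among those (automatic if `μ` is one and `r < ∞`). -/
def regularizer (p : ℝ) (μ : ProbabilityMeasure X) (r : ℝ≥0∞) (f : X → ℝ) : EReal :=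
  (⨆ ν ∈ {ν : ProbabilityMeasure X | ν ∈ finiteMoment X p ∧ wasserstein p ν μ ≤ r}, expect ν f) -
    expect μ f

/-- The Lipschitz seminorm: the supremum of `|f x - f y| / dist x y` (with `0 / 0 = 0`). -/
def lipSeminorm (f : X → ℝ) : ℝ≥0∞ :=
  ⨆ x : X, ⨆ y : X, edist (f x) (f y) / edist x y

end General

variable {d : ℕ}

/-- `f : Z → ℝ` is `α`-smooth with gradient field `g`. The gradient field is `α`-Lipschitz on the
convex hull of `Z`, and is there the gradient of an extension of `f`. If `Z` is convex, then the
convex hull is `Z` and the extension is `f` itself. -/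
def IsSmoothWithGradient (Z : Set (EuclideanSpace ℝ (Fin d))) (α : ℝ≥0) (f : Z → ℝ)
    (g : EuclideanSpace ℝ (Fin d) → EuclideanSpace ℝ (Fin d)) : Prop :=
  ∃ F : EuclideanSpace ℝ (Fin d) → ℝ,
    (∀ z : Z, F z = f z) ∧
    (∀ z ∈ convexHull ℝ Z, HasGradientWithinAt F (g z) (convexHull ℝ Z) z) ∧
    (∀ z ∈ convexHull ℝ Z, ∀ z' ∈ convexHull ℝ Z, ‖g z - g z'‖ ≤ α * ‖z - z'‖)

/-- The homogeneous Sobolev seminorm `E_μ[‖∇f‖^q]^{1/q}` of a function on `Z` with gradient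
field `g`. -/
def sobolevSeminorm {Z : Set (EuclideanSpace ℝ (Fin d))} (q : ℝ) (μ : ProbabilityMeasure Z)
    (g : EuclideanSpace ℝ (Fin d) → EuclideanSpace ℝ (Fin d)) : ℝ≥0∞ :=
  (∫⁻ z : Z, ‖g z‖ₑ ^ q ∂(μ : Measure Z)) ^ (1 / q)

end ORWDRO

end

/-!
Every feasible measure `ν` of the robust problem (`ν ∈ G` and `W_p^ε(μt, ν) ≤ ρ`) lies in the
Wasserstein ball of radius `r` around `μ`; this is `wasserstein_le_of_robustWasserstein_le`. Take
near-optimal corrections `μ'` and `ν'` of `μt`, which differ by at most `2ε` on every event. They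
have a common part: a probability measure `κ` below both `(1 - 2ε)⁻¹ μ'` and `(1 - 2ε)⁻¹ ν'`
(`exists_le_smul_both`). A plan from `μ'` to `μ` carries `κ` to a measure below `(1 - 2ε)⁻¹ μ`, at
the price of a factor `(1 - 2ε)^(-1/p)` in the cost (`exists_le_smul_wasserstein_le`), and that
measure is within the resilience `τ_p(G, 2ε)` of `μ`. The same holds for `ν`, and the triangle
inequality (`wasserstein_triangle`, by gluing plans) adds the four distances up to `r`.

Since `μ` itself is feasible, the risk of the minimizer at `μ` is at most its worst-case risk, hence
at most the worst-case risk of any competitor `ℓ`, hence at most the supremum of the risk of `ℓ`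
over the ball. This is the regularizer bound `expect_sub_le_regularizer`.

For the two explicit bounds, the increment `E_ν[ℓ] - E_μ[ℓ]` is integrated over an arbitrary
coupling. The Lipschitz bound, or the first-order Taylor bound together with the Cauchy–Schwarz
inequality, estimates it by a monotone continuous function `Φ` of the transport cost, and such a
bound passes to the infimum over couplings (`regularizer_le`). Continuity of `Φ` on all of `[0, ∞]`
requires finite coefficients, but gives the value at `r = ∞` with `0 * ∞ = 0` as well.
-/

namespace ORWDRO

open ProbabilityTheory

/-! ### Common parts of measures close in total variation -/

section TotalVariation

variable {X : Type*} [MeasurableSpace X]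

/-- The total variation distance bounds the difference of the masses of each event. The factor
`1 / 2` in its definition is absorbed because the complement contributes the same difference. -/
theorem measureReal_sub_le_of_tvDistance_le {μ ν : ProbabilityMeasure X} {ε : ℝ} (hε : 0 ≤ ε)
    (h : tvDistance μ ν ≤ ENNReal.ofReal ε) {s : Set X} (hs : MeasurableSet s) :
    |(μ : Measure X).real s - (ν : Measure X).real s| ≤ ε := by
  set σ := (μ : Measure X).toSignedMeasure - (ν : Measure X).toSignedMeasure with hσ
  have h₁ := σ.norm_le_totalVariation s
  have h₂ := σ.norm_le_totalVariation sᶜ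
  have h₃ : σ.totalVariation.real univ ≤ 2 * ε := by
    rw [tvDistance, ← hσ, ENNReal.div_le_iff (by simp) (by simp)] at h
    rw [measureReal_def]
    refine ENNReal.toReal_le_of_le_ofReal (by positivity) (h.trans_eq ?_)
    rw [mul_comm, ENNReal.ofReal_mul (by simp)]; simp
  rw [← measureReal_add_measureReal_compl hs] at h₃
  rw [hσ, Measure.toSignedMeasure_sub_apply hs, Real.norm_eq_abs] at h₁
  rw [hσ, Measure.toSignedMeasure_sub_apply hs.compl, Real.norm_eq_abs,
    probReal_compl_eq_one_sub hs, probReal_compl_eq_one_sub hs] at h₂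
  have e : 1 - (μ : Measure X).real s - (1 - (ν : Measure X).real s)
      = -((μ : Measure X).real s - (ν : Measure X).real s) := by ring
  rw [e, abs_neg] at h₂
  linarith

/-- Two probability measures that differ by at most `δ < 1` on every event have a common part of
mass at least `1 - δ`: a probability measure below `1 / (1 - δ)` times each of them. It is the
normalized minimum of the two, built from a Hahn decomposition. -/
theorem exists_le_smul_both {μ ν : ProbabilityMeasure X} {δ : ℝ} (hδ : δ < 1)
    (h : ∀ s, MeasurableSet s → (μ : Measure X).real s - (ν : Measure X).real s ≤ δ) :
    ∃ κ : ProbabilityMeasure X,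
      (κ : Measure X) ≤ ENNReal.ofReal (1 / (1 - δ)) • (μ : Measure X) ∧
      (κ : Measure X) ≤ ENNReal.ofReal (1 / (1 - δ)) • (ν : Measure X) := by
  obtain ⟨s, hs, hle, hge⟩ := exists_isHahnDecomposition (μ : Measure X) (ν : Measure X)
  -- On `s` the smaller measure is `μ`, on its complement it is `ν`, so `m` is the minimum.
  set m : Measure X := (μ : Measure X).restrict s + (ν : Measure X).restrict sᶜ with hm
  have hmμ : m ≤ μ := by
    calc m ≤ (μ : Measure X).restrict s + (μ : Measure X).restrict sᶜ := by rw [hm]; gcongr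
      _ = μ := Measure.restrict_add_restrict_compl hs
  have hmν : m ≤ ν := by
    calc m ≤ (ν : Measure X).restrict s + (ν : Measure X).restrict sᶜ := by rw [hm]; gcongr
      _ = ν := Measure.restrict_add_restrict_compl hs
  have : IsFiniteMeasure m := by rw [hm]; infer_instance
  have hmass : 1 - δ ≤ m.real univ := by
    have e : m.real univ = (μ : Measure X).real s + (ν : Measure X).real sᶜ := by
      rw [hm, measureReal_add_apply]; simp
    have := h sᶜ hs.compl
    rw [e, ← sub_nonneg]
    have h₂ := probReal_compl_eq_one_sub (μ := (μ : Measure X)) hs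
    linarith
  have hpos : 0 < m.real univ := by linarith
  have hm0 : m univ ≠ 0 := fun h0 => by simp [measureReal_def, h0] at hpos
  have hC : (m univ)⁻¹ ≤ ENNReal.ofReal (1 / (1 - δ)) := by
    rw [one_div, ENNReal.ofReal_inv_of_pos (by linarith), ENNReal.inv_le_inv,
      ENNReal.ofReal_le_iff_le_toReal (measure_ne_top _ _)]
    exact hmass
  have hκ : IsProbabilityMeasure ((m univ)⁻¹ • m) :=
    ⟨by rw [Measure.smul_apply, smul_eq_mul, ENNReal.inv_mul_cancel hm0 (measure_ne_top _ _)]⟩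
  refine ⟨⟨_, hκ⟩, ?_, ?_⟩
  · change (m univ)⁻¹ • m ≤ _
    gcongr
  · change (m univ)⁻¹ • m ≤ _
    gcongr

end TotalVariation

/-! ### Couplings and the Wasserstein distance -/

section Wasserstein

theorem prod_mem_couplings {X : Type*} [MeasurableSpace X] (μ ν : ProbabilityMeasure X) :
    μ.prod ν ∈ couplings μ ν := by
  simp [couplings, ProbabilityMeasure.toMeasure_prod, Measure.map_fst_prod, Measure.map_snd_prod]

variable {X : Type*} [MetricSpace X] [MeasurableSpace X]

/-- The `p`-th order transport cost `(E_π[dist(X,Y)^p])^{1/p}` of a plan `π`; the Wasserstein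
distance is its infimum over couplings. -/
noncomputable def transportCost (p : ℝ) (π : ProbabilityMeasure (X × X)) : ℝ≥0∞ :=
  (∫⁻ z, edist z.1 z.2 ^ p ∂(π : Measure (X × X))) ^ (1 / p)

theorem wasserstein_le_transportCost {p : ℝ} {μ ν : ProbabilityMeasure X}
    {π : ProbabilityMeasure (X × X)} (hπ : π ∈ couplings μ ν) :
    wasserstein p μ ν ≤ transportCost p π :=
  iInf₂_le π hπ

theorem exists_coupling_of_wasserstein_lt {p : ℝ} {μ ν : ProbabilityMeasure X} {a : ℝ≥0∞}
    (h : wasserstein p μ ν < a) : ∃ π ∈ couplings μ ν, transportCost p π < a := by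
  simpa [wasserstein, transportCost, iInf_lt_iff] using h

/-- A bound `a ≤ Φ (cost π)` that holds for every coupling `π` passes to the Wasserstein distance
when `Φ` is monotone and continuous. No optimal coupling is needed. -/
theorem le_of_forall_couplings {p : ℝ} {μ ν : ProbabilityMeasure X} {Φ : ℝ≥0∞ → ℝ≥0∞}
    (hmono : Monotone Φ) (hcont : Continuous Φ) {a r : ℝ≥0∞}
    (h : ∀ π ∈ couplings μ ν, a ≤ Φ (transportCost p π)) (hr : wasserstein p μ ν ≤ r) :
    a ≤ Φ r := by
  have : Nonempty (couplings μ ν) := ⟨⟨_, prod_mem_couplings μ ν⟩⟩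
  refine le_trans ?_ (hmono hr)
  have e : wasserstein p μ ν = ⨅ π : couplings μ ν, transportCost p π.1 := by
    rw [wasserstein, iInf_subtype']; rfl
  rw [e, hmono.map_ciInf_of_continuousAt hcont.continuousAt]
  exact le_iInf fun π => h π.1 π.2

theorem wasserstein_swap_le [BorelSpace X] [SecondCountableTopology X] (p : ℝ)
    (μ ν : ProbabilityMeasure X) : wasserstein p ν μ ≤ wasserstein p μ ν := by
  refine le_iInf₂ fun π hπ => ?_
  have hs : Measurable (Prod.swap : X × X → X × X) := measurable_swap
  refine (wasserstein_le_transportCost (π := π.map hs.aemeasurable) ⟨?_, ?_⟩).trans ?_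
  · rw [ProbabilityMeasure.toMeasure_map, Measure.map_map measurable_fst hs]
    exact hπ.2
  · rw [ProbabilityMeasure.toMeasure_map, Measure.map_map measurable_snd hs]
    exact hπ.1
  · rw [transportCost, ProbabilityMeasure.toMeasure_map, lintegral_map (by fun_prop) hs]
    simp [edist_comm]

theorem wasserstein_comm [BorelSpace X] [SecondCountableTopology X] (p : ℝ)
    (μ ν : ProbabilityMeasure X) : wasserstein p μ ν = wasserstein p ν μ :=
  (wasserstein_swap_le p ν μ).antisymm (wasserstein_swap_le p μ ν)

/-- **Gluing lemma**: two plans that share their first marginal are the two-dimensional marginals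
of one measure on the triple product, under which the other two coordinates are conditionally
independent. -/
theorem exists_gluing {Y : Type*} [MeasurableSpace Y] [StandardBorelSpace Y] [Nonempty Y]
    {π₁ π₂ : Measure (Y × Y)} [IsProbabilityMeasure π₁] [IsProbabilityMeasure π₂]
    (h : π₁.map Prod.fst = π₂.map Prod.fst) :
    ∃ γ : Measure (Y × Y × Y), IsProbabilityMeasure γ ∧
      γ.map (fun w => (w.1, w.2.1)) = π₁ ∧ γ.map (fun w => (w.1, w.2.2)) = π₂ := by
  refine ⟨π₁.fst ⊗ₘ (π₁.condKernel ×ₖ π₂.condKernel), inferInstance, ?_, ?_⟩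
  · have := Measure.compProd_map (μ := π₁.fst) (κ := π₁.condKernel ×ₖ π₂.condKernel)
      (f := Prod.fst) measurable_fst
    rw [← Kernel.fst_eq, Kernel.fst_prod, Measure.disintegrate] at this
    exact this.symm
  · have := Measure.compProd_map (μ := π₁.fst) (κ := π₁.condKernel ×ₖ π₂.condKernel)
      (f := Prod.snd) measurable_snd
    rw [← Kernel.snd_eq, Kernel.snd_prod, Measure.fst, h, ← Measure.fst, Measure.disintegrate]
      at this
    rw [Measure.fst, h]
    exact this.symm

theorem wasserstein_triangle [BorelSpace X] [StandardBorelSpace X] [SecondCountableTopology X]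
    {p : ℝ} (hp : 1 ≤ p) (μ₁ μ₂ μ₃ : ProbabilityMeasure X) :
    wasserstein p μ₁ μ₃ ≤ wasserstein p μ₁ μ₂ + wasserstein p μ₂ μ₃ := by
  rw [wasserstein_comm p μ₁ μ₂]
  have : Nonempty X := nonempty_of_isProbabilityMeasure (μ₁ : Measure X)
  have key : ∀ π₁ ∈ couplings μ₂ μ₁, ∀ π₂ ∈ couplings μ₂ μ₃,
      wasserstein p μ₁ μ₃ ≤ transportCost p π₁ + transportCost p π₂ := by
    intro π₁ h₁ π₂ h₂
    obtain ⟨γ, hγ, hγ₁, hγ₂⟩ := exists_gluing (h₁.1.trans h₂.1.symm)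
    have m₁ : Measurable (fun w : X × X × X => (w.1, w.2.1)) := by fun_prop
    have m₂ : Measurable (fun w : X × X × X => (w.1, w.2.2)) := by fun_prop
    have hs : Measurable (Prod.snd : X × X × X → X × X) := measurable_snd
    let γ' : ProbabilityMeasure (X × X × X) := ⟨γ, hγ⟩
    have hc : γ'.map hs.aemeasurable ∈ couplings μ₁ μ₃ := by
      constructor
      · rw [ProbabilityMeasure.toMeasure_map, Measure.map_map measurable_fst hs, ← h₁.2, ← hγ₁,
          Measure.map_map measurable_snd m₁]
        rfl
      · rw [ProbabilityMeasure.toMeasure_map, Measure.map_map measurable_snd hs, ← h₂.2, ← hγ₂,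
          Measure.map_map measurable_snd m₂]
        rfl
    refine (wasserstein_le_transportCost hc).trans ?_
    rw [transportCost, transportCost, transportCost, ProbabilityMeasure.toMeasure_map,
      lintegral_map (by fun_prop) hs, ← hγ₁, ← hγ₂, lintegral_map (by fun_prop) m₁,
      lintegral_map (by fun_prop) m₂]
    refine le_trans ?_ (ENNReal.lintegral_Lp_add_le (by fun_prop) (by fun_prop) hp)
    have : 0 ≤ 1 / p := by positivity
    refine ENNReal.rpow_le_rpow (lintegral_mono fun w => ?_) this
    refine ENNReal.rpow_le_rpow ?_ (by positivity)
    rw [Pi.add_apply, edist_comm w.1]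
    exact edist_triangle _ _ _
  have e : ∀ ν₁ ν₂ : ProbabilityMeasure X, wasserstein p ν₁ ν₂
      = ⨅ π : couplings ν₁ ν₂, transportCost p π.1 := fun ν₁ ν₂ => by
    rw [wasserstein, iInf_subtype']; rfl
  rw [e μ₂ μ₁, e μ₂ μ₃, ENNReal.iInf_add]
  refine le_iInf fun π₁ => ?_
  rw [ENNReal.add_iInf]
  exact le_iInf fun π₂ => key _ π₁.2 _ π₂.2

/-- Restricting a transport plan: a measure `κ ≤ C • μ'` is carried by a plan from `μ'` to `μ` to a
measure `κ' ≤ C • μ`, at a cost that grows by the factor `C ^ (1 / p)` at most. -/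
theorem exists_le_smul_wasserstein_le [BorelSpace X] [StandardBorelSpace X]
    [SecondCountableTopology X] {p : ℝ} (hp : 1 ≤ p) {μ' μ κ : ProbabilityMeasure X}
    {C a : ℝ≥0∞} (hκ : (κ : Measure X) ≤ C • (μ' : Measure X)) (ha : wasserstein p μ' μ < a) :
    ∃ κ' : ProbabilityMeasure X, (κ' : Measure X) ≤ C • (μ : Measure X) ∧
      wasserstein p κ κ' ≤ C ^ (1 / p) * a := by
  have : Nonempty X := nonempty_of_isProbabilityMeasure (μ : Measure X)
  obtain ⟨π, hπ, hlt⟩ := exists_coupling_of_wasserstein_lt ha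
  set K := (π : Measure (X × X)).condKernel
  have hK : (μ' : Measure X) ⊗ₘ K = π := by
    rw [← hπ.1]; exact Measure.disintegrate _ _
  -- Disintegrate the plan along its first marginal and replace that marginal by `κ`.
  let π' : ProbabilityMeasure (X × X) := ⟨(κ : Measure X) ⊗ₘ K, inferInstance⟩
  have hle : (π' : Measure (X × X)) ≤ C • (π : Measure (X × X)) := by
    rw [Measure.le_iff]
    intro s hs
    rw [← hK, Measure.smul_apply]
    change ((κ : Measure X) ⊗ₘ K) s ≤ _
    rw [Measure.compProd_apply hs, Measure.compProd_apply hs, ← lintegral_smul_measure]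
    exact lintegral_mono' hκ le_rfl
  refine ⟨π'.map measurable_snd.aemeasurable, ?_, ?_⟩
  · rw [ProbabilityMeasure.toMeasure_map, ← hπ.2, ← Measure.map_smul]
    exact Measure.map_mono hle measurable_snd
  · have hc : π' ∈ couplings κ (π'.map measurable_snd.aemeasurable) :=
      ⟨Measure.fst_compProd _ _, rfl⟩
    refine (wasserstein_le_transportCost hc).trans ?_
    have h1p : 0 ≤ 1 / p := by positivity
    calc transportCost p π' ≤ (C * ∫⁻ z, edist z.1 z.2 ^ p ∂(π : Measure (X × X))) ^ (1 / p) := by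
          rw [transportCost, ← smul_eq_mul, ← lintegral_smul_measure]
          gcongr
      _ = C ^ (1 / p) * transportCost p π := ENNReal.mul_rpow_of_nonneg _ _ h1p
      _ ≤ C ^ (1 / p) * a := by gcongr

end Wasserstein

/-! ### Comparison with the outlier-robust distance -/

section Robust

variable {X : Type*} [MetricSpace X] [MeasurableSpace X]

theorem resilience_le_classResilience {p δ : ℝ} {G : Set (ProbabilityMeasure X)}
    {μ κ : ProbabilityMeasure X} (hμ : μ ∈ G)
    (h : (κ : Measure X) ≤ ENNReal.ofReal (1 / (1 - δ)) • (μ : Measure X)) :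
    wasserstein p κ μ ≤ classResilience p G δ :=
  (le_iSup₂ (f := fun (μ' : ProbabilityMeasure X)
    (_ : (μ' : Measure X) ≤ ENNReal.ofReal (1 / (1 - δ)) • (μ : Measure X)) =>
      wasserstein p μ' μ) κ h).trans
    (le_iSup₂ (f := fun (μ : ProbabilityMeasure X) (_ : μ ∈ G) => resilience p μ δ) μ hμ)

/-- Two members of `G` that are both `ρ`-close to `μt` in the outlier-robust distance are close in
the Wasserstein distance itself. The path between them runs through the common part `κ` of
near-optimal corrections of `μt` and through the images of `κ` under near-optimal plans. -/
theorem wasserstein_le_of_robustWasserstein_le [BorelSpace X] [StandardBorelSpace X]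
    [SecondCountableTopology X] {p : ℝ} (hp : 1 ≤ p) {ρ : ℝ≥0} {ε : ℝ} (hε₀ : 0 ≤ ε)
    (hε₁ : 2 * ε < 1) {G : Set (ProbabilityMeasure X)} {μ ν μt : ProbabilityMeasure X}
    (hμ : μ ∈ G) (hν : ν ∈ G) (hμt : robustWasserstein p ε μt μ ≤ ρ)
    (hνt : robustWasserstein p ε μt ν ≤ ρ) :
    wasserstein p ν μ ≤ ENNReal.ofReal (2 * (1 - 2 * ε) ^ (-1 / p)) * ρ
      + 2 * classResilience p G (2 * ε) := by
  set τ := classResilience p G (2 * ε)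
  set C := ENNReal.ofReal (2 * (1 - 2 * ε) ^ (-1 / p)) with hC
  have hpos : 0 < 1 - 2 * ε := by linarith
  have hCC : C = 2 * ENNReal.ofReal (1 / (1 - 2 * ε)) ^ (1 / p) := by
    rw [hC, ENNReal.ofReal_rpow_of_pos (by positivity), ENNReal.ofReal_mul (by norm_num), one_div,
      Real.inv_rpow hpos.le, ← Real.rpow_neg hpos.le, neg_div, ENNReal.ofReal_ofNat]
  -- The infimum defining the robust distance is approximated with slack `a > ρ`, then `a → ρ`.
  have step : ∀ a : ℝ≥0∞, ρ < a → wasserstein p ν μ ≤ C * a + 2 * τ := by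
    intro a ha
    obtain ⟨μ', hμ', hμa⟩ : ∃ μ', tvDistance μ' μt ≤ ENNReal.ofReal ε ∧ wasserstein p μ' μ < a := by
      simpa [robustWasserstein, iInf_lt_iff] using hμt.trans_lt ha
    obtain ⟨ν', hν', hνa⟩ : ∃ ν', tvDistance ν' μt ≤ ENNReal.ofReal ε ∧ wasserstein p ν' ν < a := by
      simpa [robustWasserstein, iInf_lt_iff] using hνt.trans_lt ha
    obtain ⟨κ, hκμ, hκν⟩ := exists_le_smul_both (μ := μ') (ν := ν') hε₁ fun s hs => by
      have h₁ := abs_le.1 (measureReal_sub_le_of_tvDistance_le hε₀ hμ' hs)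
      have h₂ := abs_le.1 (measureReal_sub_le_of_tvDistance_le hε₀ hν' hs)
      linarith [h₁.2, h₂.1]
    obtain ⟨κμ, hμle, hμd⟩ := exists_le_smul_wasserstein_le hp hκμ hμa
    obtain ⟨κν, hνle, hνd⟩ := exists_le_smul_wasserstein_le hp hκν hνa
    calc wasserstein p ν μ
        ≤ wasserstein p ν κν + (wasserstein p κν κ + (wasserstein p κ κμ + wasserstein p κμ μ)) :=
          (wasserstein_triangle hp _ κν _).trans <| by
            gcongr
            refine (wasserstein_triangle hp _ κ _).trans ?_
            gcongr
            exact wasserstein_triangle hp _ κμ _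
      _ ≤ τ + (ENNReal.ofReal (1 / (1 - 2 * ε)) ^ (1 / p) * a
            + (ENNReal.ofReal (1 / (1 - 2 * ε)) ^ (1 / p) * a + τ)) := by
          rw [wasserstein_comm p ν, wasserstein_comm p κν κ]
          gcongr
          · exact resilience_le_classResilience hν hνle
          · exact resilience_le_classResilience hμ hμle
      _ = C * a + 2 * τ := by rw [hCC]; ring
  have hcont : Continuous fun a : ℝ≥0∞ => C * a + 2 * τ :=
    (ENNReal.continuous_const_mul ENNReal.ofReal_ne_top).add continuous_const
  have : (nhdsWithin (ρ : ℝ≥0∞) (Ioi (ρ : ℝ≥0∞))).NeBot := ENNReal.nhdsGT_coe_neBot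
  exact ge_of_tendsto (hcont.continuousWithinAt (s := Ioi (ρ : ℝ≥0∞))).tendsto
    (Filter.eventually_of_mem self_mem_nhdsWithin step)

/-- Optimality of `fhat` for the worst-case risk bounds its risk by the regularized risk of any
competitor, because `μ` is feasible and every feasible measure lies in the Wasserstein ball of
radius `r` around `μ`. -/
theorem expect_sub_le_regularizer [BorelSpace X] [StandardBorelSpace X]
    [SecondCountableTopology X] {p : ℝ} (hp : 1 ≤ p) {ρ : ℝ≥0} {ε : ℝ} (hε₀ : 0 ≤ ε)
    (hε₁ : 2 * ε < 1) {G : Set (ProbabilityMeasure X)} (hG : G ⊆ finiteMoment X p)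
    {μ μt : ProbabilityMeasure X} (hμ : μ ∈ G) (hμt : robustWasserstein p ε μt μ ≤ ρ)
    {f fhat : X → ℝ} (hmin : worstCaseRisk p ε ρ G μt fhat ≤ worstCaseRisk p ε ρ G μt f) :
    expect μ fhat - expect μ f ≤
      regularizer p μ (ENNReal.ofReal (2 * (1 - 2 * ε) ^ (-1 / p)) * ρ
        + 2 * classResilience p G (2 * ε)) f := by
  refine EReal.sub_le_sub ?_ le_rfl
  calc expect μ fhat ≤ worstCaseRisk p ε ρ G μt fhat :=
        le_iSup₂ (f := fun (ν : ProbabilityMeasure X)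
          (_ : ν ∈ {ν | ν ∈ G ∧ robustWasserstein p ε μt ν ≤ ρ}) => expect ν fhat) μ ⟨hμ, hμt⟩
    _ ≤ worstCaseRisk p ε ρ G μt f := hmin
    _ ≤ _ := biSup_mono fun ν hν =>
        ⟨hG hν.1, wasserstein_le_of_robustWasserstein_le hp hε₀ hε₁ hμ hν.1 hμt hν.2⟩

end Robust

/-! ### Expectations under couplings -/

section Expectation

theorem expect_eq_integral {X : Type*} [MeasurableSpace X] {μ : ProbabilityMeasure X} {f : X → ℝ}
    (hf : Integrable f (μ : Measure X)) :
    expect μ f = ((∫ z, f z ∂(μ : Measure X) : ℝ) : EReal) := by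
  rw [integral_eq_lintegral_pos_part_sub_lintegral_neg_part hf, EReal.coe_sub,
    EReal.coe_ennreal_toReal hf.lintegral_lt_top.ne,
    EReal.coe_ennreal_toReal (show ∫⁻ z, ENNReal.ofReal (-f z) ∂(μ : Measure X) ≠ ∞ from
      hf.neg.lintegral_lt_top.ne)]
  rfl

variable {X : Type*} [MetricSpace X] [MeasurableSpace X]

/-- Under a coupling, a pointwise bound on the increments of `f` bounds the difference of its
expectations. -/
theorem ofReal_integral_sub_le_lintegral {X : Type*} [MeasurableSpace X]
    {ν μ : ProbabilityMeasure X} {f : X → ℝ}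
    (hν : Integrable f (ν : Measure X)) (hμ : Integrable f (μ : Measure X))
    {π : ProbabilityMeasure (X × X)} (hπ : π ∈ couplings ν μ) {c : X × X → ℝ≥0∞}
    (hc : ∀ z, ENNReal.ofReal (f z.1 - f z.2) ≤ c z) :
    ENNReal.ofReal (∫ z, f z ∂(ν : Measure X) - ∫ z, f z ∂(μ : Measure X)) ≤
      ∫⁻ z, c z ∂(π : Measure (X × X)) := by
  rw [← hπ.1] at hν ⊢
  rw [← hπ.2] at hμ ⊢
  rw [integral_map measurable_fst.aemeasurable hν.aestronglyMeasurable,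
    integral_map measurable_snd.aemeasurable hμ.aestronglyMeasurable]
  have h₁ : Integrable (fun z : X × X => f z.1) (π : Measure (X × X)) :=
    hν.comp_measurable measurable_fst
  have h₂ : Integrable (fun z : X × X => f z.2) (π : Measure (X × X)) :=
    hμ.comp_measurable measurable_snd
  have h₃ : Integrable (fun z : X × X => f z.1 - f z.2) (π : Measure (X × X)) := h₁.sub h₂
  rw [← integral_sub h₁ h₂]
  refine le_trans ?_ (lintegral_mono hc)
  calc ENNReal.ofReal (∫ z, f z.1 - f z.2 ∂(π : Measure (X × X)))
      ≤ ENNReal.ofReal (∫ z, max (f z.1 - f z.2) 0 ∂(π : Measure (X × X))) :=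
        ENNReal.ofReal_le_ofReal (integral_mono h₃ h₃.pos_part fun z => le_max_left _ _)
    _ = ∫⁻ z, ENNReal.ofReal (f z.1 - f z.2) ∂(π : Measure (X × X)) := by
        rw [ofReal_integral_eq_lintegral_ofReal h₃.pos_part (ae_of_all _ fun z => le_max_right _ _)]
        simp [ENNReal.ofReal_max]

theorem integrable_of_norm_le_dist_rpow [BorelSpace X] {p : ℝ} (hp : 0 ≤ p)
    {μ : ProbabilityMeasure X} (hμ : μ ∈ finiteMoment X p) {f : X → ℝ} (hf : Measurable f)
    (hgrowth : ∀ z₀, ∃ A B : ℝ, ∀ z, ‖f z‖ ≤ A + B * dist z z₀ ^ p) :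
    Integrable f (μ : Measure X) := by
  rw [finiteMoment, mem_ofPred_eq, iInf_lt_iff] at hμ
  obtain ⟨z₀, hz₀⟩ := hμ
  obtain ⟨A, B, h⟩ := hgrowth z₀
  have hd : Integrable (fun z => dist z z₀ ^ p) (μ : Measure X) := by
    refine ⟨((continuous_id.dist continuous_const).measurable.pow_const p).aestronglyMeasurable, ?_⟩
    rw [hasFiniteIntegral_iff_ofReal (ae_of_all _ fun z => by positivity)]
    refine lt_of_eq_of_lt (lintegral_congr fun z => ?_) hz₀
    rw [edist_dist, ENNReal.ofReal_rpow_of_nonneg dist_nonneg hp]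
  exact ((integrable_const A).add (hd.const_mul B)).mono' hf.aestronglyMeasurable (ae_of_all _ h)

/-- An upper bound on the regularizer by a continuous modulus `Φ` of the transport cost. -/
theorem regularizer_le {p : ℝ} {μ : ProbabilityMeasure X} (hμ : μ ∈ finiteMoment X p)
    {f : X → ℝ} (hint : ∀ ν ∈ finiteMoment X p, Integrable f (ν : Measure X)) {Φ : ℝ≥0∞ → ℝ≥0∞}
    (hmono : Monotone Φ) (hcont : Continuous Φ)
    (h : ∀ ν ∈ finiteMoment X p, ∀ π ∈ couplings ν μ,
      ENNReal.ofReal (∫ z, f z ∂(ν : Measure X) - ∫ z, f z ∂(μ : Measure X))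
        ≤ Φ (transportCost p π)) (r : ℝ≥0∞) :
    regularizer p μ r f ≤ (Φ r : EReal) := by
  refine EReal.sub_le_of_le_add (iSup₂_le fun ν hν => ?_)
  have hle := le_of_forall_couplings hmono hcont (h ν hν.1) hν.2
  rw [expect_eq_integral (hint ν hν.1), expect_eq_integral (hint μ hμ)]
  have h₁ : (((∫ z, f z ∂(ν : Measure X) - ∫ z, f z ∂(μ : Measure X) : ℝ)) : EReal) ≤ Φ r := by
    refine le_trans ?_ (EReal.coe_ennreal_le_coe_ennreal_iff.2 hle)
    rw [EReal.coe_ennreal_ofReal]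
    exact EReal.coe_le_coe_iff.2 (le_max_left _ _)
  calc ((∫ z, f z ∂(ν : Measure X) : ℝ) : EReal)
      = ((∫ z, f z ∂(ν : Measure X) - ∫ z, f z ∂(μ : Measure X) : ℝ) : EReal)
        + ((∫ z, f z ∂(μ : Measure X) : ℝ) : EReal) := by
        rw [← EReal.coe_add, sub_add_cancel]
    _ ≤ _ := by gcongr

end Expectation

/-! ### Lipschitz losses -/

section Lipschitz

variable {X : Type*} [MetricSpace X]

theorem lipSeminorm_le {f : X → ℝ} {K : ℝ≥0} (hf : LipschitzWith K f) : lipSeminorm f ≤ K :=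
  iSup₂_le fun x y => ENNReal.div_le_of_le_mul (hf x y)

theorem edist_le_lipSeminorm_mul (f : X → ℝ) (x y : X) :
    edist (f x) (f y) ≤ lipSeminorm f * edist x y := by
  rcases eq_or_ne x y with rfl | hxy
  · simp
  · rw [← ENNReal.div_le_iff (edist_pos.2 hxy).ne' (edist_ne_top _ _)]
    exact le_iSup₂ (f := fun x y : X => edist (f x) (f y) / edist x y) x y

theorem regularizer_one_le_of_lipschitzWith [MeasurableSpace X] [BorelSpace X]
    [SecondCountableTopology X]
    {μ : ProbabilityMeasure X} (hμ : μ ∈ finiteMoment X 1) {f : X → ℝ} {K : ℝ≥0}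
    (hf : LipschitzWith K f) (r : ℝ≥0∞) :
    regularizer 1 μ r f ≤ ((lipSeminorm f * r : ℝ≥0∞) : EReal) := by
  have hint : ∀ ν ∈ finiteMoment X 1, Integrable f (ν : Measure X) := fun ν hν =>
    integrable_of_norm_le_dist_rpow zero_le_one hν hf.continuous.measurable fun z₀ =>
      ⟨‖f z₀‖, K, fun z => by
        have h₁ := hf.dist_le_mul z z₀
        have h₂ := norm_le_norm_add_norm_sub' (f z) (f z₀)
        rw [dist_eq_norm] at h₁
        rw [Real.rpow_one]
        linarith⟩
  refine regularizer_le (Φ := fun c => lipSeminorm f * c) hμ hint (fun a b hab => by dsimp; gcongr)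
    (ENNReal.continuous_const_mul ((lipSeminorm_le hf).trans_lt ENNReal.coe_lt_top).ne)
    (fun ν hν π hπ => ?_) r
  refine (ofReal_integral_sub_le_lintegral (hint ν hν) (hint μ hμ) hπ
    (c := fun z => lipSeminorm f * edist z.1 z.2) fun z => ?_).trans_eq ?_
  · refine le_trans ?_ (edist_le_lipSeminorm_mul f z.1 z.2)
    rw [edist_dist, Real.dist_eq]
    exact ENNReal.ofReal_le_ofReal (le_abs_self _)
  · rw [lintegral_const_mul _ (by fun_prop), transportCost]
    simp

end Lipschitz

/-! ### Smooth losses -/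

section Smooth

open scoped InnerProductSpace

/-- First-order Taylor bound on a convex set for a function with `α`-Lipschitz gradient: along the
segment from `y` to `x`, subtracting the quadratic bound leaves a nonincreasing function. -/
theorem sub_le_inner_gradient_add {E : Type*} [NormedAddCommGroup E] [InnerProductSpace ℝ E]
    [CompleteSpace E] {s : Set E} (hs : Convex ℝ s) {F : E → ℝ} {g : E → E} {α : ℝ}
    (hF : ∀ z ∈ s, HasGradientWithinAt F (g z) s z)
    (hg : ∀ z ∈ s, ∀ z' ∈ s, ‖g z - g z'‖ ≤ α * ‖z - z'‖) {x y : E} (hx : x ∈ s) (hy : y ∈ s) :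
    F x - F y ≤ ⟪g y, x - y⟫_ℝ + α / 2 * ‖x - y‖ ^ 2 := by
  set v := x - y with hv
  have hmem : ∀ t ∈ Icc (0 : ℝ) 1, y + t • v ∈ s := fun t ht => hs.add_smul_sub_mem hy hx ht
  have hline : ∀ t : ℝ, HasDerivAt (fun t : ℝ => y + t • v) v t := fun t => by
    simpa using ((hasDerivAt_id t).smul_const v).const_add y
  have hder : ∀ t ∈ Icc (0 : ℝ) 1, HasDerivWithinAt
      (fun t => F (y + t • v) - t * ⟪g y, v⟫_ℝ - α / 2 * ‖v‖ ^ 2 * t ^ 2)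
      (⟪g (y + t • v), v⟫_ℝ - ⟪g y, v⟫_ℝ - α * ‖v‖ ^ 2 * t) (Icc 0 1) t := by
    intro t ht
    have h₁ := (hF _ (hmem t ht)).hasFDerivWithinAt.comp_hasDerivWithinAt t
      (hline t).hasDerivWithinAt hmem
    have h₂ := ((hasDerivAt_id t).mul_const ⟪g y, v⟫_ℝ).hasDerivWithinAt (s := Icc 0 1)
    have h₃ := ((hasDerivAt_pow 2 t).const_mul (α / 2 * ‖v‖ ^ 2)).hasDerivWithinAt (s := Icc 0 1)
    refine ((h₁.sub h₂).sub h₃).congr_deriv ?_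
    simp only [InnerProductSpace.toDual_apply_apply, one_mul]
    ring
  have hanti := antitoneOn_of_hasDerivWithinAt_nonpos (convex_Icc (0 : ℝ) 1)
    (fun t ht => (hder t ht).continuousWithinAt)
    (fun t ht => (hder t (interior_subset ht)).mono interior_subset) fun t ht => by
      have ht' := interior_subset ht
      have h₁ : ⟪g (y + t • v) - g y, v⟫_ℝ ≤ α * ‖v‖ ^ 2 * t := by
        calc ⟪g (y + t • v) - g y, v⟫_ℝ ≤ ‖g (y + t • v) - g y‖ * ‖v‖ := real_inner_le_norm _ _
          _ ≤ α * ‖y + t • v - y‖ * ‖v‖ := by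
            gcongr
            exact hg _ (hmem t ht') _ hy
          _ = α * ‖v‖ ^ 2 * t := by
            rw [add_sub_cancel_left, norm_smul, Real.norm_of_nonneg ht'.1]; ring
      rw [inner_sub_left] at h₁
      linarith
  have h := hanti (left_mem_Icc.2 zero_le_one) (right_mem_Icc.2 zero_le_one) zero_le_one
  simp only [one_smul, zero_smul, add_zero, hv, add_sub_cancel] at h
  rw [← hv] at h
  linarith

variable {d : ℕ} {Z : Set (EuclideanSpace ℝ (Fin d))} {α : ℝ≥0} {f : Z → ℝ}
  {g : EuclideanSpace ℝ (Fin d) → EuclideanSpace ℝ (Fin d)}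

theorem IsSmoothWithGradient.lipschitzWith (h : IsSmoothWithGradient Z α f g) :
    LipschitzWith α fun z : Z => g z := by
  obtain ⟨F, -, -, hg⟩ := h
  refine LipschitzWith.of_dist_le_mul fun x y => ?_
  rw [dist_eq_norm, Subtype.dist_eq, dist_eq_norm]
  exact hg _ (subset_convexHull ℝ Z x.2) _ (subset_convexHull ℝ Z y.2)

theorem IsSmoothWithGradient.continuous (h : IsSmoothWithGradient Z α f g) : Continuous f := by
  obtain ⟨F, hFf, hF, -⟩ := h
  have h₁ : ContinuousOn F Z := fun z hz =>
    ((hF z (subset_convexHull ℝ Z hz)).hasFDerivWithinAt.continuousWithinAt).mono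
      (subset_convexHull ℝ Z)
  have h₂ : f = Z.domRestrict F := funext fun z => (hFf z).symm
  rw [h₂]
  exact h₁.domRestrict

theorem IsSmoothWithGradient.sub_le (h : IsSmoothWithGradient Z α f g) (x y : Z) :
    f x - f y ≤ ‖g y‖ * dist x y + α / 2 * dist x y ^ 2 := by
  obtain ⟨F, hFf, hF, hg⟩ := h
  have h₁ := sub_le_inner_gradient_add (convex_convexHull ℝ Z) hF hg
    (subset_convexHull ℝ Z x.2) (subset_convexHull ℝ Z y.2)
  have h₂ := real_inner_le_norm (g y) (x - y : EuclideanSpace ℝ (Fin d))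
  rw [Subtype.dist_eq, dist_eq_norm, ← hFf, ← hFf]
  linarith

theorem IsSmoothWithGradient.neg (h : IsSmoothWithGradient Z α f g) :
    IsSmoothWithGradient Z α (-f) (-g) := by
  obtain ⟨F, hFf, hF, hg⟩ := h
  refine ⟨-F, fun z => by simp [hFf], fun z hz => ?_, fun z hz z' hz' => ?_⟩
  · rw [hasGradientWithinAt_iff_hasFDerivWithinAt, Pi.neg_apply, map_neg]
    exact (hF z hz).hasFDerivWithinAt.neg
  · rw [Pi.neg_apply, Pi.neg_apply, neg_sub_neg, norm_sub_rev]
    exact hg z hz z' hz'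

theorem IsSmoothWithGradient.integrable (h : IsSmoothWithGradient Z α f g)
    {ν : ProbabilityMeasure Z} (hν : ν ∈ finiteMoment Z 2) : Integrable f (ν : Measure Z) := by
  refine integrable_of_norm_le_dist_rpow zero_le_two hν h.continuous.measurable fun z₀ =>
    ⟨‖f z₀‖ + ‖g z₀‖ ^ 2, 1 + α / 2, fun z => ?_⟩
  have h₁ := h.sub_le z z₀
  have h₂ := h.neg.sub_le z z₀
  simp only [Pi.neg_apply, norm_neg] at h₂
  have h₃ : ‖f z - f z₀‖ ≤ ‖g z₀‖ * dist z z₀ + α / 2 * dist z z₀ ^ 2 :=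
    abs_le.2 ⟨by linarith, h₁⟩
  have h₄ := norm_le_norm_add_norm_sub' (f z) (f z₀)
  rw [Real.rpow_two]
  -- The mixed term is split by `2ab ≤ a² + b²`.
  nlinarith [sq_nonneg (‖g z₀‖ - dist z z₀), sq_nonneg (‖g z₀‖), sq_nonneg (dist z z₀)]

/-- A Lipschitz gradient field is square integrable under a measure with finite second moment. -/
theorem IsSmoothWithGradient.sobolevSeminorm_ne_top (h : IsSmoothWithGradient Z α f g)
    {μ : ProbabilityMeasure Z} (hμ : μ ∈ finiteMoment Z 2) : sobolevSeminorm 2 μ g ≠ ∞ := by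
  have hcont : Continuous fun z : Z => g z := h.lipschitzWith.continuous
  have hint : Integrable (fun z : Z => ‖g z‖ ^ 2) (μ : Measure Z) := by
    refine integrable_of_norm_le_dist_rpow zero_le_two hμ (hcont.norm.pow 2).measurable fun z₀ =>
      ⟨2 * ‖g z₀‖ ^ 2, 2 * α ^ 2, fun z => ?_⟩
    have h₁ := h.lipschitzWith.dist_le_mul z z₀
    have h₂ := norm_le_norm_add_norm_sub' (g z) (g z₀)
    rw [dist_eq_norm] at h₁
    rw [Real.rpow_two, Real.norm_of_nonneg (by positivity)]
    have h₃ : ‖g z‖ ^ 2 ≤ (‖g z₀‖ + α * dist z z₀) ^ 2 := by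
      gcongr; linarith
    nlinarith [sq_nonneg (‖g z₀‖ - α * dist z z₀)]
  rw [sobolevSeminorm]
  refine ENNReal.rpow_ne_top_of_nonneg (by norm_num) ?_
  convert hint.2.ne using 3 with z
  simp [enorm_pow]

theorem regularizer_two_le_of_isSmoothWithGradient (h : IsSmoothWithGradient Z α f g)
    {μ : ProbabilityMeasure Z} (hμ : μ ∈ finiteMoment Z 2) (r : ℝ≥0∞) :
    regularizer 2 μ r f ≤
      ((sobolevSeminorm 2 μ g * r + (α : ℝ≥0∞) / 2 * r ^ 2 : ℝ≥0∞) : EReal) := by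
  have hS := h.sobolevSeminorm_ne_top hμ
  have hα : (α : ℝ≥0∞) / 2 ≠ ∞ := ENNReal.div_ne_top ENNReal.coe_ne_top two_ne_zero
  have hcont : Continuous fun z : Z => g z := h.lipschitzWith.continuous
  refine regularizer_le (Φ := fun c => sobolevSeminorm 2 μ g * c + (α : ℝ≥0∞) / 2 * c ^ 2) hμ
    (fun ν hν => h.integrable hν) (fun a b hab => by dsimp; gcongr)
    ((ENNReal.continuous_const_mul hS).add
      ((ENNReal.continuous_const_mul hα).comp (ENNReal.continuous_pow 2)))
    (fun ν hν π hπ => ?_) r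
  have hm : Measurable fun z : Z × Z => ‖g z.2‖ₑ :=
    hcont.enorm.measurable.comp measurable_snd
  refine (ofReal_integral_sub_le_lintegral (h.integrable hν) (h.integrable hμ) hπ
    (c := fun z => ‖g z.2‖ₑ * edist z.1 z.2 + (α : ℝ≥0∞) / 2 * edist z.1 z.2 ^ (2 : ℝ))
    fun z => ?_).trans ?_
  · refine (ENNReal.ofReal_le_ofReal (h.sub_le z.1 z.2)).trans_eq ?_
    rw [ENNReal.ofReal_add (by positivity) (by positivity), ENNReal.ofReal_mul (by positivity),
      ENNReal.ofReal_mul (by positivity), ENNReal.ofReal_div_of_pos (by norm_num),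
      ENNReal.ofReal_pow dist_nonneg, ← edist_dist, ofReal_norm, ENNReal.ofReal_coe_nnreal,
      ENNReal.ofReal_ofNat, ENNReal.rpow_two]
  · rw [lintegral_add_left (by fun_prop), lintegral_const_mul _ (by fun_prop)]
    refine add_le_add ?_ (le_of_eq ?_)
    · refine (ENNReal.lintegral_mul_le_Lp_mul_Lq _ Real.HolderConjugate.two_two hm.aemeasurable
        (g := fun z : Z × Z => edist z.1 z.2) (by fun_prop)).trans_eq ?_
      rw [sobolevSeminorm, transportCost, ← hπ.2,
        lintegral_map (hcont.enorm.measurable.pow_const _) measurable_snd]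
    · rw [transportCost, ← ENNReal.rpow_natCast, ← ENNReal.rpow_mul]
      norm_num

end Smooth

end ORWDRO

theorem mainTheorem1 {d : ℕ} {Z : Set (EuclideanSpace ℝ (Fin d))} (hZ : IsClosed Z)
    {p : ℝ} (hp : 1 ≤ p) (ρ : ℝ≥0) {ε : ℝ} (hε₀ : 0 ≤ ε) (hε₁ : ε ≤ 0.49)
    (L : Set (Z → ℝ))
    (hL : ∀ ℓ ∈ L, LowerSemicontinuous ℓ ∧
      BddAbove (Set.range fun z : Z => ℓ z / (1 + ‖(z : EuclideanSpace ℝ (Fin d))‖ ^ p)))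
    (G : Set (ProbabilityMeasure Z)) (hG : G ⊆ ORWDRO.finiteMoment Z p)
    (μ : ProbabilityMeasure Z) (hμ : μ ∈ G)
    (μt : ProbabilityMeasure Z) (hμt : ORWDRO.robustWasserstein p ε μt μ ≤ ρ)
    (ℓhat : Z → ℝ) (hℓhat : ℓhat ∈ L)
    (hmin : IsMinOn (ORWDRO.worstCaseRisk p ε ρ G μt) L ℓhat)
    (r : ℝ≥0∞)
    (hr : r = ENNReal.ofReal (2 * (1 - 2 * ε) ^ (-1 / p)) * ρ
      + 2 * ORWDRO.classResilience p G (2 * ε)) :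
    (∀ ℓ ∈ L, ORWDRO.expect μ ℓhat - ORWDRO.expect μ ℓ ≤ ORWDRO.regularizer p μ r ℓ) ∧
    (p = 1 → ∀ ℓstar ∈ L, IsMinOn (ORWDRO.expect μ) L ℓstar →
      (∃ K : ℝ≥0, LipschitzWith K ℓstar) →
      ORWDRO.expect μ ℓhat - ORWDRO.expect μ ℓstar ≤
        ((ORWDRO.lipSeminorm ℓstar * r : ℝ≥0∞) : EReal)) ∧
    (p = 2 → ∀ ℓstar ∈ L, IsMinOn (ORWDRO.expect μ) L ℓstar →
      ∀ (α : ℝ≥0) (g : EuclideanSpace ℝ (Fin d) → EuclideanSpace ℝ (Fin d)),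
      ORWDRO.IsSmoothWithGradient Z α ℓstar g →
      ORWDRO.expect μ ℓhat - ORWDRO.expect μ ℓstar ≤
        ((ORWDRO.sobolevSeminorm 2 μ g * r + (α : ℝ≥0∞) / 2 * r ^ 2 : ℝ≥0∞) : EReal)) := by
  -- Closedness of `Z` enters only here: plans on `Z` can be disintegrated and glued.
  have : StandardBorelSpace Z := hZ.measurableSet.standardBorel
  have hμp := hG hμ
  have key : ∀ ℓ ∈ L, ORWDRO.expect μ ℓhat - ORWDRO.expect μ ℓ ≤ ORWDRO.regularizer p μ r ℓ :=
    fun ℓ hℓ => hr ▸ ORWDRO.expect_sub_le_regularizer hp hε₀ (by linarith) hG hμ hμt (hmin hℓ)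
  refine ⟨key, ?_, ?_⟩
  · rintro rfl ℓstar hℓ - ⟨K, hK⟩
    exact (key ℓstar hℓ).trans (ORWDRO.regularizer_one_le_of_lipschitzWith hμp hK r)
  · rintro rfl ℓstar hℓ - α g hg
    exact (key ℓstar hℓ).trans (ORWDRO.regularizer_two_le_of_isSmoothWithGradient hg hμp r)
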